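/- Let $\Sigma=\{0,1\}^{\mathbb N}$, with the metric for which two distinct points that first differ in their $n$-th coordinate, $n\ge 1$, are at distance $2^{-(n-1)}$ (so cylinders of generation $n$ have diameter $2^{-n}$). Write $I_{\epsilon_1\dots\epsilon_n}$ for the cylinder of points of $\Sigma$ whose first $n$ coordinates are $\epsilon_1,\dots,\epsilon_n$, $\mathcal F_n$ for the set of cylinders of generation $n$, and $I_n(x)$ for the one that contains $x$. For a sequence $(p_n)_{n\ge1}$ in $(0,1)$, the Bernoulli product with weights $(p_n)$ is the Borel measure $\mu$ on $\Sigma$ with $$\mu(I_{\epsilon_1\dots\epsilon_n})=\prod_{j=1}^n p_j^{1-\epsilon_j}(1-p_j)^{\epsilon_j}$$ for all $n$ and all $\epsilon_1,\dots,\epsilon_n\in\{0,1\}$. The homogeneous Bernoulli measure $\beta(p)$ is the case where $p_n=p$ for all $n$. For a probability measure $m$ on $\Sigma$ put $$\tau_m(q)=\limsup_{n\to\infty}\frac1{n\log 2}\log\sum_{I\in\mathcal F_n,\ m(I)\ne0}m(I)^q\quad(q\in\mathbb R),\qquad \tau_m^*(\alpha)=\inf_{q\in\mathbb R}\bigl(\alpha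 q+\tau_m(q)\bigr)\quad(\alpha\in\mathbb R),$$ $$E_\alpha(m)=\Bigl\{x\in\Sigma:\ \liminf_{n\to\infty}-\frac{\log m(I_n(x))}{n\log 2}=\alpha\Bigr\}.$$ We say that $m$ satisfies the multifractal formalism if $\dim E_\alpha(m)=\tau_m^*(\alpha)$ for every $\alpha\in\mathbb R$, where $\dim$ is the Hausdorff dimension with the convention $\dim\emptyset=-\infty$. Let $p\in(0,1)$. (1) For every sequence $(p_n)$ in $(0,1)$ with $p_n\to p$, the Bernoulli product $\mu$ with weights $(p_n)$ satisfies $\tau_\mu=\tau_{\beta(p)}$, that is, $\tau_\mu(q)=\log_2\bigl(p^q+(1-p)^q\bigr)$ for all $q\in\mathbb R$, and $\mu$ satisfies the multifractal formalism. (2) There is a sequence $(p_n)$ in $(0,1)$ with $p_n\to p$ such that the Bernoulli product with weights $(p_n)$ and the homogeneous Bernoulli measure $\beta(p)$ are mutually singular. -/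

import Mathlib

open Set Filter Topology MeasureTheory

namespace BernoulliProduct

noncomputable section

/-- The Cantor set `{0,1}^ℕ`, with `false` in the role of `0` and `true` in the role of `1`.
Coordinates are numbered from `0`. It carries the product σ-algebra, which is its Borel σ-algebra. -/
abbrev Cantor : Type := ℕ → Bool

/-- The cylinder of generation `n` given by the word `e` of length `n`. -/
def cyl {n : ℕ} (e : Fin n → Bool) : Set Cantor := {x | ∀ i : Fin n, x i = e i}

/-- The cylinder `I_n(x)` of generation `n` containing `x`. -/
def cylAt (n : ℕ) (x : Cantor) : Set Cantor := cyl fun i : Fin n => x i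

/-- `μ` is the inhomogeneous Bernoulli product with weights `w`: the mass of the cylinder of the
word `e` is the product over its letters of `w j` (letter `0`) or `1 - w j` (letter `1`). -/
def IsBernoulliProduct (w : ℕ → ℝ) (μ : Measure Cantor) : Prop :=
  ∀ (n : ℕ) (e : Fin n → Bool),
    μ (cyl e) = ENNReal.ofReal (∏ j : Fin n, if e j then 1 - w j else w j)

/-- `τ_n(q) = (1 / (n log 2)) log ∑ m(I)^q`, the sum over the cylinders `I` of generation `n`
with `m(I) ≠ 0`. -/
def tauN (m : Measure Cantor) (n : ℕ) (q : ℝ) : ℝ :=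
  open Classical in
  1 / (n * Real.log 2) *
    Real.log (∑ e : Fin n → Bool with m (cyl e) ≠ 0, m.real (cyl e) ^ q)

/-- The `L^q`-spectrum `τ(q) = limsup τ_n(q)`, with values in `[-∞, ∞]`. -/
def tau (m : Measure Cantor) (q : ℝ) : EReal :=
  limsup (fun n : ℕ => (tauN m n q : EReal)) atTop

/-- The Legendre transform `τ*(α) = inf {α q + τ(q) : q ∈ ℝ}`, with values in `[-∞, ∞]`. -/
def tauStar (m : Measure Cantor) (α : ℝ) : EReal :=
  ⨅ q : ℝ, ((α * q : ℝ) : EReal) + tau m q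

/-- The local dimension `α(x) = liminf - log m(I_n(x)) / (n log 2)`, where `log 0 = -∞`. -/
def localDim (m : Measure Cantor) (x : Cantor) : EReal :=
  liminf (fun n : ℕ => -ENNReal.log (m (cylAt n x)) / ((n * Real.log 2 : ℝ) : EReal)) atTop

/-- The level set `E_α = {x : α(x) = α}`. -/
def levelSet (m : Measure Cantor) (α : ℝ) : Set Cantor := {x | localDim m x = (α : EReal)}

/-- The Hausdorff dimension of a subset of the Cantor set, for the metric
`d(x, y) = 2^(-n)`, with `n` the first coordinate where `x` and `y` differ, so that cylinders of
generation `n` have diameter `2^(-n)`; the empty set has dimension `-∞`. -/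
def hausdorffDim (s : Set Cantor) : EReal :=
  open Classical in
  letI : MetricSpace Cantor := PiNat.metricSpace
  if s = ∅ then ⊥ else ((dimH s : ENNReal) : EReal)

/-- The multifractal formalism: `dim E_α = τ*(α)` for all `α`. Since `dim ∅ = -∞`, this includes
that `E_α` is empty exactly when the infimum defining `τ*(α)` is `-∞`. -/
def MultifractalFormalism (m : Measure Cantor) : Prop :=
  ∀ α : ℝ, hausdorffDim (levelSet m α) = tauStar m α

end

end BernoulliProduct

/-!
**The level sets do not see the perturbation.** Along every point `x`, the exponent
`-log₂ μ(I_n(x)) / n` is an average over the first `n` letters of `-log₂` of their weights. When the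
weights converge to `p`, Cesàro averaging makes it asymptotic to the exponent of the homogeneous
measure `β(p)` at the same point. Hence the level sets of `μ` and `β(p)` are the same
(`IsBernoulliProduct.mem_levelSet_iff`), and the same averaging gives the `L^q`-spectrum
(`IsBernoulliProduct.tau_eq`), since the partition sum factors over the letters.

**The formalism.** For each `q`, the homogeneous Bernoulli measure with weight
`p ^ q / (p ^ q + (1 - p) ^ q)` is a Gibbs measure: its exponent at `x` is `q` times that of `β(p)` plus
`τ(q)`. On the level set of `α` this is frequently close to or below `α q + τ(q)`, so that covering by
heavy cylinders bounds the dimension by `α q + τ(q)` for all `q`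
(`IsBernoulliProduct.hausdorffDim_levelSet_le`). If `q` is a critical point of `α q + τ(q)`, the law of
large numbers puts the Gibbs measure on the level set, and the mass distribution principle gives the
reverse bound (`IsBernoulliProduct.le_hausdorffDim_levelSet`). A critical point exists for `α` strictly
between `-log₂ p` and `-log₂ (1 - p)`, or equal to both. For `α` equal to only one of them the
infimum is at most `0` and the level set contains a constant sequence. For `α` outside the closed
interval the infimum is `-∞`, so nothing is left to prove.

**Singularity.** The affinity of two coins is at most `1 - (s - t) ^ 2 / 8`, so two Bernoulli products
whose weights differ by a sequence that is not square summable have Hellinger affinity `0`, and are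
mutually singular (`IsBernoulliProduct.mutuallySingular`). Deviations of order `n ^ (-1/2)` from `p` are
small enough to converge and large enough for this.
-/

namespace BernoulliProduct

open scoped ENNReal NNReal

noncomputable section

/-! ### Cylinders and Bernoulli measures -/

/-- The weight of the letter `c` under the coin that gives `false` (the letter `0`) the weight `t`. -/
def letterWeight (t : ℝ) (c : Bool) : ℝ := if c then 1 - t else t

lemma letterWeight_pos {t : ℝ} (ht : t ∈ Ioo (0 : ℝ) 1) (c : Bool) : 0 < letterWeight t c := by
  cases c <;> simp [letterWeight, ht.1, ht.2]

lemma letterWeight_lt_one {t : ℝ} (ht : t ∈ Ioo (0 : ℝ) 1) (c : Bool) : letterWeight t c < 1 := by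
  cases c <;> simp [letterWeight, ht.1, ht.2]

lemma measurableSet_cyl {n : ℕ} (e : Fin n → Bool) : MeasurableSet (cyl e) := by
  have : cyl e = ⋂ i : Fin n, (fun x : Cantor => x i) ⁻¹' {e i} := by
    ext x; simp [cyl]
  rw [this]
  exact MeasurableSet.iInter fun i => measurable_pi_apply _ (measurableSet_singleton _)

lemma mem_cylAt {n : ℕ} {x y : Cantor} : y ∈ cylAt n x ↔ ∀ i < n, y i = x i :=
  ⟨fun h i hi => h ⟨i, hi⟩, fun h i => h i i.2⟩

lemma mem_cylAt_self (n : ℕ) (x : Cantor) : x ∈ cylAt n x := fun _ => rfl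

lemma pairwise_disjoint_cyl (n : ℕ) :
    Pairwise (Function.onFun Disjoint (cyl : (Fin n → Bool) → Set Cantor)) := by
  intro e e' hne
  refine Set.disjoint_left.2 fun x hx hx' => hne (funext fun i => ?_)
  rw [← hx i, hx' i]

lemma iUnion_cyl (n : ℕ) : ⋃ e : Fin n → Bool, cyl e = univ :=
  eq_univ_of_forall fun x => mem_iUnion.2 ⟨fun i => x i, mem_cylAt_self n x⟩

lemma sum_measure_cyl (ν : Measure Cantor) (n : ℕ) :
    ∑ e : Fin n → Bool, ν (cyl e) = ν univ := by
  rw [← iUnion_cyl n, measure_iUnion (pairwise_disjoint_cyl n) measurableSet_cyl, tsum_fintype]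

/-- A sum over words of a product over letters is the product of the one-letter sums. -/
lemma sum_words_prod (n : ℕ) (f : ℕ → Bool → ℝ) :
    ∑ e : Fin n → Bool, ∏ j : Fin n, f j (e j)
      = ∏ j ∈ Finset.range n, (f j false + f j true) := by
  rw [Finset.prod_range, ← Fintype.piFinset_univ,
    ← Finset.prod_univ_sum (fun _ => Finset.univ) (fun (j : Fin n) c => f j c)]
  exact Finset.prod_congr rfl fun j _ => by rw [Fintype.sum_bool, add_comm]

lemma IsBernoulliProduct.measure_cylAt {w : ℕ → ℝ} {μ : Measure Cantor}
    (h : IsBernoulliProduct w μ) (n : ℕ) (x : Cantor) :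
    μ (cylAt n x) = ENNReal.ofReal (∏ j ∈ Finset.range n, letterWeight (w j) (x j)) := by
  rw [cylAt, h, Finset.prod_range]; rfl

/-- The law on letters that gives `false` the mass `t` and `true` the mass `1 - t`. -/
def coin (t : Icc (0 : ℝ) 1) : Measure Bool :=
  ENNReal.ofReal t • Measure.dirac false + ENNReal.ofReal (1 - t) • Measure.dirac true

lemma coin_singleton (t : Icc (0 : ℝ) 1) (c : Bool) :
    coin t {c} = ENNReal.ofReal (letterWeight t c) := by
  cases c <;> simp [coin, letterWeight]

instance (t : Icc (0 : ℝ) 1) : IsProbabilityMeasure (coin t) where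
  measure_univ := by
    simp [coin, ← ENNReal.ofReal_add t.2.1 (sub_nonneg.2 t.2.2)]

lemma integral_coin (t : Icc (0 : ℝ) 1) (f : Bool → ℝ) :
    ∫ c, f c ∂(coin t) = t * f false + (1 - t) * f true := by
  rw [integral_fintype (Integrable.of_finite), Fintype.sum_bool]
  simp [Measure.real, coin_singleton, letterWeight, t.2.1, t.2.2]
  ring

/-- The product of the coins `coin (w n)`. The weights live in `[0, 1]` so that it is a probability
measure without side conditions. -/
def bernoulliMeasure (w : ℕ → Icc (0 : ℝ) 1) : Measure Cantor :=
  Measure.infinitePi fun n => coin (w n)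

instance (w : ℕ → Icc (0 : ℝ) 1) : IsProbabilityMeasure (bernoulliMeasure w) := by
  unfold bernoulliMeasure; infer_instance

lemma isBernoulliProduct_bernoulliMeasure (w : ℕ → Icc (0 : ℝ) 1) :
    IsBernoulliProduct (fun n => w n) (bernoulliMeasure w) := by
  intro n e
  have : cyl e = Set.pi (Finset.range n : Set ℕ)
      (fun i => {if h : i < n then e ⟨i, h⟩ else false}) := by
    ext x
    simp only [cyl, mem_ofPred_eq, Set.mem_pi, Finset.coe_range, mem_Iio, mem_singleton_iff]
    exact ⟨fun h i hi => by simpa [hi] using h ⟨i, hi⟩, fun h i => by simpa using h i i.2⟩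
  rw [this, bernoulliMeasure, Measure.infinitePi_pi _ fun _ _ => measurableSet_singleton _,
    Finset.prod_range, ENNReal.ofReal_prod_of_nonneg]
  · exact Finset.prod_congr rfl fun j _ => by simp [coin_singleton, letterWeight]
  · intro j _
    split_ifs
    · exact sub_nonneg.2 (w j).2.2
    · exact (w j).2.1

/-- The strong law of large numbers for a function of one letter. -/
lemma ae_tendsto_birkhoff (t : Icc (0 : ℝ) 1) (f : Bool → ℝ) :
    ∀ᵐ x ∂(bernoulliMeasure fun _ => t),
      Tendsto (fun n : ℕ => (∑ j ∈ Finset.range n, f (x j)) / n) atTop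
        (𝓝 (t * f false + (1 - t) * f true)) := by
  have hf : Measurable f := measurable_of_finite f
  have hmap (i : ℕ) := measurePreserving_eval_infinitePi (fun _ : ℕ => coin t) i
  have hind := ProbabilityTheory.iIndepFun_infinitePi (P := fun _ : ℕ => coin t)
    (X := fun _ => f) fun _ => hf
  have key := ProbabilityTheory.strong_law_ae_real (μ := bernoulliMeasure fun _ => t)
    (fun n x => f (x n)) ?_ (fun i j hij => hind.indepFun hij) ?_
  · have hint : ∫ x, f (x 0) ∂(bernoulliMeasure fun _ => t) = t * f false + (1 - t) * f true := by
      rw [← integral_coin, ← (hmap 0).map_eq, integral_map]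
      · rfl
      · exact (measurable_pi_apply 0).aemeasurable
      · exact hf.aestronglyMeasurable
    rwa [hint] at key
  · exact (hmap 0).integrable_comp_of_integrable (Integrable.of_finite)
  · intro i
    refine ⟨(hf.comp (measurable_pi_apply i)).aemeasurable,
      (hf.comp (measurable_pi_apply 0)).aemeasurable, ?_⟩
    have (k : ℕ) : Measure.map (fun x : Cantor => f (x k)) (bernoulliMeasure fun _ => t)
        = Measure.map f (coin t) := by
      rw [← (hmap k).map_eq, Measure.map_map hf (hmap k).measurable]
      rfl
    rw [this, this]

/-! ### Mass distribution on the Cantor set -/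

section
attribute [local instance] PiNat.metricSpace

lemma borelSpace_cantor : BorelSpace Cantor := Pi.borelSpace

lemma ofReal_half_pow (n : ℕ) : ENNReal.ofReal ((1 / 2) ^ n) = (2 : ℝ≥0∞) ^ (-(n : ℝ)) := by
  rw [ENNReal.rpow_neg, ENNReal.rpow_natCast, ENNReal.ofReal_pow (by norm_num), ENNReal.inv_pow]
  simp

lemma tendsto_two_rpow_neg : Tendsto (fun n : ℕ => (2 : ℝ≥0∞) ^ (-(n : ℝ))) atTop (𝓝 0) := by
  have h (n : ℕ) : (2 : ℝ≥0∞) ^ (-(n : ℝ)) = 2⁻¹ ^ n := by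
    rw [ENNReal.rpow_neg, ENNReal.rpow_natCast, ENNReal.inv_pow]
  simp only [h]
  exact ENNReal.tendsto_pow_atTop_nhds_zero_of_lt_one (by norm_num)

lemma ediam_cyl_le {n : ℕ} (e : Fin n → Bool) : Metric.ediam (cyl e) ≤ (2 : ℝ≥0∞) ^ (-(n : ℝ)) := by
  refine Metric.ediam_le fun x hx y hy => ?_
  have h : dist x y ≤ (1 / 2) ^ n := by
    rw [← PiNat.mem_cylinder_iff_dist_le, PiNat.mem_cylinder_iff]
    intro i hi
    exact (hx ⟨i, hi⟩).trans (hy ⟨i, hi⟩).symm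
  rw [edist_dist]
  exact (ENNReal.ofReal_le_ofReal h).trans (ofReal_half_pow n).le

lemma subset_cylAt_of_ediam_le {n : ℕ} {s : Set Cantor} {x : Cantor} (hx : x ∈ s)
    (h : Metric.ediam s ≤ (2 : ℝ≥0∞) ^ (-(n : ℝ))) : s ⊆ cylAt n x := by
  intro y hy
  rw [mem_cylAt]
  have h1 : edist y x ≤ ENNReal.ofReal ((1 / 2) ^ n) :=
    (Metric.edist_le_ediam_of_mem hy hx).trans (h.trans (ofReal_half_pow n).ge)
  rw [edist_dist, ENNReal.ofReal_le_ofReal_iff (by positivity)] at h1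
  exact PiNat.mem_cylinder_iff.1 (PiNat.mem_cylinder_iff_dist_le.2 h1)

/-- The metric takes only the values `0` and `2 ^ (-n)`, so diameters do as well. -/
lemma exists_ediam_eq {s : Set Cantor} (hs : Metric.ediam s ≠ 0) :
    ∃ n : ℕ, Metric.ediam s = (2 : ℝ≥0∞) ^ (-(n : ℝ)) := by
  classical
  have hex : ∃ n : ℕ, ∃ y ∈ s, ∃ z ∈ s, y ≠ z ∧ PiNat.firstDiff y z = n := by
    by_contra! h
    refine hs (Metric.ediam_eq_zero_iff.2 fun y hy z hz => ?_)
    by_contra hne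
    exact h _ y hy z hz hne rfl
  obtain ⟨y, hy, z, hz, hne, hyz⟩ := Nat.find_spec hex
  refine ⟨Nat.find hex, le_antisymm (Metric.ediam_le fun a ha b hb => ?_) ?_⟩
  · rcases eq_or_ne a b with rfl | hab
    · simp
    rw [edist_dist, ← ofReal_half_pow, PiNat.dist_eq_of_ne hab]
    exact ENNReal.ofReal_le_ofReal (pow_le_pow_of_le_one (by norm_num) (by norm_num)
      (Nat.find_min' hex ⟨a, ha, b, hb, hab, rfl⟩))
  · refine le_trans (le_of_eq ?_) (Metric.edist_le_ediam_of_mem hy hz)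
    rw [edist_dist, ← ofReal_half_pow, PiNat.dist_eq_of_ne hne, hyz]

/-- If every point of `E` lies in infinitely many cylinders of mass at least `2 ^ (-n s)`, then
`dim E ≤ d` for all `d > s`: at most `2 ^ (n s)` cylinders of generation `n` are that heavy, and the heavy cylinders
of large generation cover `E`. -/
theorem dimH_le_of_frequently {ν : Measure Cantor} [IsProbabilityMeasure ν] {s : ℝ} {d : ℝ≥0}
    (hsd : s < d) {E : Set Cantor}
    (hE : ∀ x ∈ E, ∃ᶠ n : ℕ in atTop, (2 : ℝ≥0∞) ^ (-(n * s)) ≤ ν (cylAt n x)) :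
    dimH E ≤ d := by
  have := borelSpace_cantor
  refine dimH_le_of_hausdorffMeasure_ne_top (ne_top_of_le_ne_top ENNReal.zero_ne_top ?_)
  let ι : ℕ → Type := fun N =>
    Σ n : ℕ, {e : Fin (n + N) → Bool // (2 : ℝ≥0∞) ^ (-((n + N : ℕ) * s)) ≤ ν (cyl e)}
  have key := Measure.hausdorffMeasure_le_liminf_tsum (ι := ι) (l := atTop) d E
    (fun N : ℕ => (2 : ℝ≥0∞) ^ (-(N : ℝ))) ?_ (fun N i => cyl i.2.1) ?_ ?_
  · refine key.trans (le_of_eq (Tendsto.liminf_eq ?_))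
    have hgeo : Tendsto (fun N : ℕ => ∑' n : ℕ, ((2 : ℝ≥0∞) ^ (s - d)) ^ (n + N)) atTop (𝓝 0) := by
      refine ENNReal.tendsto_sum_nat_add (fun n => ((2 : ℝ≥0∞) ^ (s - d)) ^ n) ?_
      rw [ENNReal.tsum_geometric, ENNReal.inv_ne_top, Ne, tsub_eq_zero_iff_le, not_le]
      exact ENNReal.rpow_lt_one_of_one_lt_of_neg (by norm_num) (by linarith)
    refine tendsto_of_tendsto_of_tendsto_of_le_of_le tendsto_const_nhds hgeo
      (fun _ => zero_le) fun N => ?_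
    rw [ENNReal.tsum_sigma (fun (n : ℕ)
      (e : {e : Fin (n + N) → Bool // (2 : ℝ≥0∞) ^ (-((n + N : ℕ) * s)) ≤ ν (cyl e)}) =>
        Metric.ediam (cyl e.1) ^ (d : ℝ))]
    refine ENNReal.tsum_le_tsum fun n => ?_
    rw [tsum_fintype]
    set m := n + N
    calc ∑ e : {e : Fin m → Bool // (2 : ℝ≥0∞) ^ (-(m * s)) ≤ ν (cyl e)},
          Metric.ediam (cyl e.1) ^ (d : ℝ)
        ≤ ∑ e : {e : Fin m → Bool // (2 : ℝ≥0∞) ^ (-(m * s)) ≤ ν (cyl e)},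
            ((2 : ℝ≥0∞) ^ (s - d)) ^ m * ν (cyl e.1) := by
          refine Finset.sum_le_sum fun e _ => ?_
          refine le_trans ?_ (mul_le_mul_right e.2 _)
          refine (ENNReal.rpow_le_rpow (ediam_cyl_le e.1) d.2).trans (le_of_eq ?_)
          rw [← ENNReal.rpow_natCast, ← ENNReal.rpow_mul, ← ENNReal.rpow_mul,
            ← ENNReal.rpow_add _ _ (by norm_num) (by norm_num)]
          congr 1; simp only [NNReal.val_eq_coe]; ring
      _ ≤ ∑ e : Fin m → Bool, ((2 : ℝ≥0∞) ^ (s - d)) ^ m * ν (cyl e) := by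
          rw [← tsum_fintype (L := .unconditional _), ← tsum_fintype (L := .unconditional _)]
          exact ENNReal.tsum_comp_le_tsum_of_injective Subtype.val_injective
            (fun e : Fin m → Bool => ((2 : ℝ≥0∞) ^ (s - d)) ^ m * ν (cyl e))
      _ = _ := by rw [← Finset.mul_sum, sum_measure_cyl, measure_univ, mul_one]
  · exact tendsto_two_rpow_neg
  · refine Eventually.of_forall fun N i => (ediam_cyl_le _).trans ?_
    refine ENNReal.rpow_le_rpow_of_exponent_le (by norm_num) ?_
    push_cast; linarith [Nat.cast_nonneg (α := ℝ) i.1]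
  · refine Eventually.of_forall fun N x hx => ?_
    obtain ⟨n, hn, hle⟩ := frequently_atTop.1 (hE x hx) N
    obtain ⟨k, rfl⟩ := Nat.exists_eq_add_of_le' hn
    exact mem_iUnion.2 ⟨⟨k, ⟨fun i => x i, hle⟩⟩, mem_cylAt_self _ x⟩

/-- The mass distribution principle: if almost every point lies in `E` and its cylinders eventually
have mass at most `2 ^ (-n d)`, then `dim E ≥ d`. -/
theorem le_dimH_of_ae_eventually {ν : Measure Cantor} [IsProbabilityMeasure ν] {d : ℝ≥0}
    (hd : 0 < d) {E : Set Cantor}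
    (hE : ∀ᵐ x ∂ν, x ∈ E ∧ ∀ᶠ n : ℕ in atTop, ν (cylAt n x) ≤ (2 : ℝ≥0∞) ^ (-(n * d : ℝ))) :
    d ≤ dimH E := by
  have := borelSpace_cantor
  -- Restricted to `F N`, where the mass bound is uniform, `ν` is dominated by Hausdorff measure.
  let F : ℕ → Set Cantor := fun N =>
    {x | ∀ n ≥ N, ν (cylAt n x) ≤ (2 : ℝ≥0∞) ^ (-(n * d : ℝ))}
  have hFm (N : ℕ) : MeasurableSet (F N) := by
    simp only [F, ge_iff_le, ofPred_forall]
    refine MeasurableSet.iInter fun n => MeasurableSet.iInter fun _ => ?_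
    have : Measurable fun x : Cantor => ν (cylAt n x) :=
      (measurable_of_finite fun e : Fin n → Bool => ν (cyl e)).comp
        (measurable_pi_lambda _ fun i => measurable_pi_apply _)
    exact this measurableSet_Iic
  have hpos : ∃ N, ν (E ∩ F N) ≠ 0 := by
    by_contra! h
    have h0 : ν (⋃ N, E ∩ F N) = 0 := measure_iUnion_null h
    have h1 : ∀ᵐ x ∂ν, x ∈ ⋃ N, E ∩ F N := by
      filter_upwards [hE] with x hx
      obtain ⟨N, hN⟩ := eventually_atTop.1 hx.2
      exact mem_iUnion.2 ⟨N, hx.1, hN⟩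
    have h2 : ∀ᵐ x ∂ν, x ∉ ⋃ N, E ∩ F N := measure_eq_zero_iff_ae_notMem.1 h0
    obtain ⟨x, hx1, hx2⟩ := (h1.and h2).exists
    exact hx2 hx1
  obtain ⟨N, hN⟩ := hpos
  refine le_dimH_of_hausdorffMeasure_ne_zero fun h0 => hN ?_
  have hle : ν.restrict (F N) ≤ Measure.hausdorffMeasure d := by
    refine Measure.le_hausdorffMeasure _ _ ((2 : ℝ≥0∞) ^ (-(N : ℝ)))
      (ENNReal.rpow_pos (by norm_num) (by norm_num)) fun s hs => ?_
    rw [Measure.restrict_apply' (hFm N)]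
    rcases (s ∩ F N).eq_empty_or_nonempty with he | ⟨x, hxs, hxF⟩
    · simp [he]
    have step (n : ℕ) (hn : N ≤ n) (h : Metric.ediam s ≤ (2 : ℝ≥0∞) ^ (-(n : ℝ))) :
        ν (s ∩ F N) ≤ ((2 : ℝ≥0∞) ^ (-(n : ℝ))) ^ (d : ℝ) := by
      rw [← ENNReal.rpow_mul, neg_mul]
      exact (measure_mono (inter_subset_left.trans (subset_cylAt_of_ediam_le hxs h))).trans
        (hxF n hn)
    by_cases hz : Metric.ediam s = 0
    · have hlim : Tendsto (fun n : ℕ => ((2 : ℝ≥0∞) ^ (-(n : ℝ))) ^ (d : ℝ)) atTop (𝓝 0) := by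
        simpa [ENNReal.zero_rpow_of_pos (NNReal.coe_pos.2 hd)] using
          tendsto_two_rpow_neg.ennrpow_const (d : ℝ)
      have : ν (s ∩ F N) ≤ 0 := ge_of_tendsto hlim (by
        filter_upwards [eventually_ge_atTop N] with n hn
        exact step n hn (by simp [hz]))
      exact this.trans zero_le
    · obtain ⟨n, hn⟩ := exists_ediam_eq hz
      rw [hn]
      refine step n ?_ hn.le
      rw [hn] at hs
      by_contra! hlt
      refine absurd hs (not_le.2 (ENNReal.rpow_lt_rpow_of_exponent_lt (by norm_num) (by norm_num) ?_))
      exact neg_lt_neg (Nat.cast_lt.2 hlt)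
  have := hle E
  rw [Measure.restrict_apply' (hFm N), h0] at this
  exact le_antisymm this zero_le

end

/-! ### Coarse local exponents and the `L^q`-spectrum -/

/-- The coarse local exponent `-log₂ μ(I_n(x)) / n` of the Bernoulli product with weights `w`, written
as the average of `-log₂` of the weights of the first `n` letters of `x`. It is `0` for `n = 0`. -/
def coarseExp (w : ℕ → ℝ) (n : ℕ) (x : Cantor) : ℝ :=
  (∑ j ∈ Finset.range n, -Real.logb 2 (letterWeight (w j) (x j))) / n

lemma prod_letterWeight_eq {w : ℕ → ℝ} (hw : ∀ n, w n ∈ Ioo (0 : ℝ) 1) (n : ℕ) (x : Cantor) :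
    ∏ j ∈ Finset.range n, letterWeight (w j) (x j) = 2 ^ (-(n * coarseExp w n x)) := by
  rcases Nat.eq_zero_or_pos n with rfl | hn
  · simp
  have h : -(n * coarseExp w n x) = ∑ j ∈ Finset.range n, Real.logb 2 (letterWeight (w j) (x j)) := by
    have : (n : ℝ) ≠ 0 := by positivity
    rw [coarseExp, Finset.sum_neg_distrib]
    field_simp
  rw [h, Real.rpow_sum_of_pos (by norm_num)]
  exact Finset.prod_congr rfl fun j _ =>
    (Real.rpow_logb (by norm_num) (by norm_num) (letterWeight_pos (hw j) _)).symm

lemma IsBernoulliProduct.measure_cylAt_eq_rpow {w : ℕ → ℝ} (hw : ∀ n, w n ∈ Ioo (0 : ℝ) 1)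
    {μ : Measure Cantor} (h : IsBernoulliProduct w μ) (n : ℕ) (x : Cantor) :
    μ (cylAt n x) = (2 : ℝ≥0∞) ^ (-(n * coarseExp w n x)) := by
  rw [h.measure_cylAt, prod_letterWeight_eq hw, ← ENNReal.ofReal_rpow_of_pos (by norm_num)]
  simp

lemma IsBernoulliProduct.localDim_eq {w : ℕ → ℝ} (hw : ∀ n, w n ∈ Ioo (0 : ℝ) 1)
    {μ : Measure Cantor} (h : IsBernoulliProduct w μ) (x : Cantor) :
    localDim μ x = liminf (fun n : ℕ => (coarseExp w n x : EReal)) atTop := by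
  refine liminf_congr ?_
  filter_upwards [eventually_gt_atTop 0] with n hn
  rw [h.measure_cylAt, prod_letterWeight_eq hw, ENNReal.log_ofReal_of_pos (by positivity),
    ← EReal.coe_neg, ← EReal.coe_div, Real.log_rpow (by norm_num)]
  congr 1
  have : (n : ℝ) ≠ 0 := by positivity
  have : Real.log 2 ≠ 0 := (Real.log_pos (by norm_num)).ne'
  field_simp

lemma tendsto_logb_letterWeight {w : ℕ → ℝ} {p : ℝ} (hp : p ∈ Ioo (0 : ℝ) 1)
    (hwp : Tendsto w atTop (𝓝 p)) (c : Bool) :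
    Tendsto (fun n => Real.logb 2 (letterWeight (w n) c)) atTop
      (𝓝 (Real.logb 2 (letterWeight p c))) := by
  have h : Tendsto (fun n => letterWeight (w n) c) atTop (𝓝 (letterWeight p c)) := by
    cases c
    · simpa [letterWeight] using hwp
    · simpa [letterWeight] using hwp.const_sub 1
  exact (h.log (letterWeight_pos hp c).ne').div_const _

lemma tendsto_average {u : ℕ → ℝ} {l : ℝ} (h : Tendsto u atTop (𝓝 l)) :
    Tendsto (fun n : ℕ => (∑ j ∈ Finset.range n, u j) / n) atTop (𝓝 l) := by
  simpa only [div_eq_inv_mul] using h.cesaro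

/-- Convergent weights only perturb the exponents by a Cesàro average of terms that tend to `0`,
whatever the point `x`. -/
lemma tendsto_coarseExp_sub {w : ℕ → ℝ} {p : ℝ} (hp : p ∈ Ioo (0 : ℝ) 1)
    (hwp : Tendsto w atTop (𝓝 p)) (x : Cantor) :
    Tendsto (fun n => coarseExp w n x - coarseExp (fun _ => p) n x) atTop (𝓝 0) := by
  have hc (c : Bool) : Tendsto (fun n => |Real.logb 2 (letterWeight p c) -
      Real.logb 2 (letterWeight (w n) c)|) atTop (𝓝 0) := by
    simpa using ((tendsto_logb_letterWeight hp hwp c).const_sub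
      (Real.logb 2 (letterWeight p c))).abs
  have hterm : Tendsto (fun n => Real.logb 2 (letterWeight p (x n)) -
      Real.logb 2 (letterWeight (w n) (x n))) atTop (𝓝 0) := by
    refine squeeze_zero_norm (fun n => ?_) (by simpa using (hc false).add (hc true))
    rw [Real.norm_eq_abs]
    cases x n <;> simp
  refine (tendsto_average hterm).congr fun n => ?_
  rw [coarseExp, coarseExp, ← sub_div, ← Finset.sum_sub_distrib]
  congr 1
  exact Finset.sum_congr rfl fun j _ => by ring

lemma coarseExp_nonneg {w : ℕ → ℝ} (hw : ∀ n, w n ∈ Ioo (0 : ℝ) 1) (n : ℕ) (x : Cantor) :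
    0 ≤ coarseExp w n x :=
  div_nonneg (Finset.sum_nonneg fun j _ => neg_nonneg.2 (Real.logb_nonpos (by norm_num)
    (letterWeight_pos (hw j) _).le (letterWeight_lt_one (hw j) _).le)) n.cast_nonneg

lemma IsBernoulliProduct.tauN_eq {w : ℕ → ℝ} (hw : ∀ n, w n ∈ Ioo (0 : ℝ) 1)
    {μ : Measure Cantor} (h : IsBernoulliProduct w μ) (n : ℕ) (q : ℝ) :
    tauN μ n q = (∑ j ∈ Finset.range n, Real.logb 2 (w j ^ q + (1 - w j) ^ q)) / n := by
  classical
  have hpos (e : Fin n → Bool) : 0 < ∏ j : Fin n, letterWeight (w j) (e j) :=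
    Finset.prod_pos fun j _ => letterWeight_pos (hw j) _
  have hcyl (e : Fin n → Bool) :
      μ (cyl e) = ENNReal.ofReal (∏ j : Fin n, letterWeight (w j) (e j)) := h n e
  have hsum : (∑ e : Fin n → Bool with μ (cyl e) ≠ 0, μ.real (cyl e) ^ q)
      = ∏ j ∈ Finset.range n, (w j ^ q + (1 - w j) ^ q) := by
    rw [Finset.filter_true_of_mem fun e _ => by
      rw [hcyl]; exact (ENNReal.ofReal_pos.2 (hpos e)).ne']
    have := sum_words_prod n fun j c => letterWeight (w j) c ^ q
    simp only [letterWeight, Bool.false_eq_true, if_false, if_true] at this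
    rw [← this]
    refine Finset.sum_congr rfl fun e _ => ?_
    rw [Measure.real, hcyl, ENNReal.toReal_ofReal (hpos e).le,
      ← Real.finsetProd_rpow _ _ fun (j : Fin n) _ => (letterWeight_pos (hw j) (e j)).le]
    rfl
  have hne (j : ℕ) : w j ^ q + (1 - w j) ^ q ≠ 0 :=
    (add_pos (Real.rpow_pos_of_pos (hw j).1 _)
      (Real.rpow_pos_of_pos (sub_pos.2 (hw j).2) _)).ne'
  simp only [tauN]
  rw [hsum, Real.log_prod fun j _ => hne j]
  simp only [Real.logb, ← Finset.sum_div]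
  field_simp

lemma IsBernoulliProduct.tau_eq {w : ℕ → ℝ} (hw : ∀ n, w n ∈ Ioo (0 : ℝ) 1) {p : ℝ}
    (hp : p ∈ Ioo (0 : ℝ) 1) (hwp : Tendsto w atTop (𝓝 p))
    {μ : Measure Cantor} (h : IsBernoulliProduct w μ) (q : ℝ) :
    tau μ q = ((Real.logb 2 (p ^ q + (1 - p) ^ q) : ℝ) : EReal) := by
  have hp1 : 0 < 1 - p := sub_pos.2 hp.2
  have hlim : Tendsto (fun n => Real.logb 2 (w n ^ q + (1 - w n) ^ q)) atTop
      (𝓝 (Real.logb 2 (p ^ q + (1 - p) ^ q))) := by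
    have h1 := (hwp.rpow_const (p := q) (Or.inl hp.1.ne')).add
      ((hwp.const_sub 1).rpow_const (p := q) (Or.inl hp1.ne'))
    exact (h1.log (add_pos (Real.rpow_pos_of_pos hp.1 _)
      (Real.rpow_pos_of_pos hp1 _)).ne').div_const _
  refine Tendsto.limsup_eq ((continuous_coe_real_ereal.tendsto _).comp
    ((tendsto_average hlim).congr fun n => (h.tauN_eq hw n q).symm))

lemma liminf_eq_coe_iff {u : ℕ → ℝ} {α : ℝ} :
    liminf (fun n => (u n : EReal)) atTop = α ↔
      (∀ ε > 0, ∀ᶠ n in atTop, α - ε < u n) ∧ (∀ ε > 0, ∃ᶠ n in atTop, u n < α + ε) := by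
  constructor
  · intro h
    refine ⟨fun ε hε => ?_, fun ε hε => ?_⟩
    · have : ((α - ε : ℝ) : EReal) < liminf (fun n => (u n : EReal)) atTop := by
        rw [h, EReal.coe_lt_coe_iff]; linarith
      exact (eventually_lt_of_lt_liminf this).mono fun n hn => EReal.coe_lt_coe_iff.1 hn
    · have : liminf (fun n => (u n : EReal)) atTop < ((α + ε : ℝ) : EReal) := by
        rw [h, EReal.coe_lt_coe_iff]; linarith
      exact (frequently_lt_of_liminf_lt (by isBoundedDefault) this).mono
        fun n hn => EReal.coe_lt_coe_iff.1 hn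
  · rintro ⟨h1, h2⟩
    refine le_antisymm (EReal.le_of_forall_lt_iff_le.1 fun z hz => ?_)
      (EReal.ge_of_forall_gt_iff_ge.1 fun z hz => ?_)
    · have := h2 (z - α) (sub_pos.2 (EReal.coe_lt_coe_iff.1 hz))
      exact liminf_le_of_frequently_le (this.mono fun n hn => by
        rw [add_sub_cancel] at hn; exact (EReal.coe_lt_coe_iff.2 hn).le)
    · have := h1 (α - z) (sub_pos.2 (EReal.coe_lt_coe_iff.1 hz))
      exact le_liminf_of_le (by isBoundedDefault) (this.mono fun n hn => by
        rw [sub_sub_cancel] at hn; exact (EReal.coe_lt_coe_iff.2 hn).le)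

/-! ### Gibbs weights and level sets -/

lemma liminf_eq_coe_of_tendsto_sub {u v : ℕ → ℝ} (h : Tendsto (fun n => u n - v n) atTop (𝓝 0))
    {α : ℝ} (hu : liminf (fun n => (u n : EReal)) atTop = α) :
    liminf (fun n => (v n : EReal)) atTop = α := by
  rw [liminf_eq_coe_iff] at hu ⊢
  have hsmall (ε : ℝ) (hε : 0 < ε) : ∀ᶠ n in atTop, |u n - v n| < ε / 2 := by
    simpa [Real.dist_eq] using Metric.tendsto_nhds.1 h (ε / 2) (half_pos hε)
  refine ⟨fun ε hε => ?_, fun ε hε => ?_⟩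
  · filter_upwards [hu.1 (ε / 2) (half_pos hε), hsmall ε hε] with n h1 h2
    linarith [(abs_lt.1 h2).2]
  · refine ((hu.2 (ε / 2) (half_pos hε)).and_eventually (hsmall ε hε)).mono fun n hn => ?_
    linarith [(abs_lt.1 hn.2).1, hn.1]

/-- The level sets depend on the weights only through their limit. -/
lemma IsBernoulliProduct.mem_levelSet_iff {w : ℕ → ℝ} (hw : ∀ n, w n ∈ Ioo (0 : ℝ) 1) {p : ℝ}
    (hp : p ∈ Ioo (0 : ℝ) 1) (hwp : Tendsto w atTop (𝓝 p))
    {μ : Measure Cantor} (h : IsBernoulliProduct w μ) {α : ℝ} {x : Cantor} :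
    x ∈ levelSet μ α ↔
      liminf (fun n => (coarseExp (fun _ => p) n x : EReal)) atTop = α := by
  have hlim := tendsto_coarseExp_sub hp hwp x
  rw [levelSet, mem_ofPred_eq, h.localDim_eq hw]
  exact ⟨liminf_eq_coe_of_tendsto_sub hlim,
    liminf_eq_coe_of_tendsto_sub (by simpa using hlim.neg)⟩

/-- The logarithm `log₂ (p ^ q + (1 - p) ^ q)` of the one-letter partition function, which is the
`L^q`-spectrum of the homogeneous Bernoulli measure. -/
def pressure (p q : ℝ) : ℝ := Real.logb 2 (p ^ q + (1 - p) ^ q)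

/-- The weight of the letter `0` in the Gibbs measure at inverse temperature `q`. -/
def gibbsWeight (p q : ℝ) : ℝ := p ^ q / (p ^ q + (1 - p) ^ q)

lemma partition_pos {p : ℝ} (hp : p ∈ Ioo (0 : ℝ) 1) (q : ℝ) : 0 < p ^ q + (1 - p) ^ q :=
  add_pos (Real.rpow_pos_of_pos hp.1 _) (Real.rpow_pos_of_pos (sub_pos.2 hp.2) _)

lemma letterWeight_gibbsWeight {p : ℝ} (hp : p ∈ Ioo (0 : ℝ) 1) (q : ℝ) (c : Bool) :
    letterWeight (gibbsWeight p q) c = letterWeight p c ^ q / (p ^ q + (1 - p) ^ q) := by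
  have := (partition_pos hp q).ne'
  cases c
  · simp [letterWeight, gibbsWeight]
  · simp only [letterWeight, gibbsWeight, if_true]
    field_simp
    ring

lemma gibbsWeight_mem {p : ℝ} (hp : p ∈ Ioo (0 : ℝ) 1) (q : ℝ) :
    gibbsWeight p q ∈ Ioo (0 : ℝ) 1 := by
  have h1 := Real.rpow_pos_of_pos hp.1 q
  have h2 := Real.rpow_pos_of_pos (sub_pos.2 hp.2) q
  exact ⟨div_pos h1 (partition_pos hp q), (div_lt_one (partition_pos hp q)).2 (by linarith)⟩

lemma coarseExp_gibbsWeight {p : ℝ} (hp : p ∈ Ioo (0 : ℝ) 1) (q : ℝ) {n : ℕ} (hn : 0 < n)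
    (x : Cantor) :
    coarseExp (fun _ => gibbsWeight p q) n x = q * coarseExp (fun _ => p) n x + pressure p q := by
  have hterm (c : Bool) : -Real.logb 2 (letterWeight (gibbsWeight p q) c)
      = q * -Real.logb 2 (letterWeight p c) + pressure p q := by
    have hc := letterWeight_pos hp c
    rw [letterWeight_gibbsWeight hp, Real.logb_div (Real.rpow_pos_of_pos hc _).ne'
      (partition_pos hp q).ne', Real.logb_rpow_eq_mul_logb_of_pos hc, pressure]
    ring
  have : (n : ℝ) ≠ 0 := by positivity
  simp only [coarseExp, hterm, Finset.sum_add_distrib, ← Finset.mul_sum, Finset.sum_const,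
    Finset.card_range, nsmul_eq_mul]
  field_simp

/-- The homogeneous Bernoulli measure with the Gibbs weight: up to the factor `2 ^ (-n pressure)`, it
gives a cylinder the `q`-th power of its mass under the Bernoulli measure of weight `p`. -/
def gibbsMeasure (p q : ℝ) (hp : p ∈ Ioo (0 : ℝ) 1) : Measure Cantor :=
  bernoulliMeasure fun _ => ⟨gibbsWeight p q, Ioo_subset_Icc_self (gibbsWeight_mem hp q)⟩

instance (p q : ℝ) (hp : p ∈ Ioo (0 : ℝ) 1) : IsProbabilityMeasure (gibbsMeasure p q hp) := by
  unfold gibbsMeasure; infer_instance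

lemma gibbsMeasure_cylAt {p : ℝ} (hp : p ∈ Ioo (0 : ℝ) 1) (q : ℝ) {n : ℕ} (hn : 0 < n)
    (x : Cantor) : gibbsMeasure p q hp (cylAt n x)
      = (2 : ℝ≥0∞) ^ (-(n * (q * coarseExp (fun _ => p) n x + pressure p q))) := by
  rw [← coarseExp_gibbsWeight hp q hn]
  exact (isBernoulliProduct_bernoulliMeasure _).measure_cylAt_eq_rpow
    (fun _ => gibbsWeight_mem hp q) n x

lemma frequently_mul_coarseExp_lt {u : ℕ → ℝ} {α : ℝ}
    (h : liminf (fun n => (u n : EReal)) atTop = α) (q : ℝ) {ε : ℝ} (hε : 0 < ε) :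
    ∃ᶠ n in atTop, q * u n < α * q + ε := by
  rw [liminf_eq_coe_iff] at h
  rcases le_or_gt 0 q with hq | hq
  · refine (h.2 (ε / (q + 1)) (by positivity)).mono fun n hn => ?_
    have h1 : q * u n ≤ q * (α + ε / (q + 1)) := mul_le_mul_of_nonneg_left hn.le hq
    have h2 : q * (ε / (q + 1)) < ε := by
      rw [mul_div_assoc', div_lt_iff₀ (by positivity)]; nlinarith
    linarith
  · refine (h.1 (ε / -q) (div_pos hε (neg_pos.2 hq))).frequently.mono fun n hn => ?_
    have h1 := mul_lt_mul_of_neg_left hn hq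
    have h2 : q * (ε / -q) = -ε := by
      have := hq.ne
      field_simp
    linarith

section
attribute [local instance] PiNat.metricSpace

lemma hausdorffDim_of_nonempty {s : Set Cantor} (hs : s.Nonempty) :
    hausdorffDim s = ((dimH s : ℝ≥0∞) : EReal) := if_neg hs.ne_empty

lemma hausdorffDim_nonneg {s : Set Cantor} (hs : s.Nonempty) : 0 ≤ hausdorffDim s := by
  rw [hausdorffDim_of_nonempty hs]; exact EReal.coe_ennreal_nonneg _

/-- The upper bound holds for the lower local dimension at negative `q` as well, since then the mass
of the Gibbs measure is bounded below at all large generations. -/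
theorem IsBernoulliProduct.hausdorffDim_levelSet_le {w : ℕ → ℝ} (hw : ∀ n, w n ∈ Ioo (0 : ℝ) 1)
    {p : ℝ} (hp : p ∈ Ioo (0 : ℝ) 1) (hwp : Tendsto w atTop (𝓝 p))
    {μ : Measure Cantor} (h : IsBernoulliProduct w μ) (α q : ℝ) :
    hausdorffDim (levelSet μ α) ≤ ((α * q + pressure p q : ℝ) : EReal) := by
  rcases (levelSet μ α).eq_empty_or_nonempty with he | hne
  · simp [hausdorffDim, he]
  set g := α * q + pressure p q
  have hfreq (x : Cantor) (hx : x ∈ levelSet μ α) (s : ℝ) (hs : g < s) :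
      ∃ᶠ n : ℕ in atTop, 0 < n ∧ q * coarseExp (fun _ => p) n x + pressure p q < s := by
    have := frequently_mul_coarseExp_lt ((h.mem_levelSet_iff hw hp hwp).1 hx) q (sub_pos.2 hs)
    refine (this.and_eventually (eventually_gt_atTop 0)).mono fun n hn => ⟨hn.2, ?_⟩
    linarith [hn.1]
  -- The exponents of the Gibbs measure are nonnegative, and frequently below any `s > g` on the
  -- nonempty level set.
  have hg : 0 ≤ g := by
    obtain ⟨x, hx⟩ := hne
    refine le_of_forall_gt_imp_ge_of_dense fun s hs => ?_
    obtain ⟨n, hn, hlt⟩ := (hfreq x hx s hs).exists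
    rw [← coarseExp_gibbsWeight hp q hn] at hlt
    exact (coarseExp_nonneg (fun _ => gibbsWeight_mem hp q) n x).trans hlt.le
  rw [hausdorffDim_of_nonempty hne]
  refine EReal.le_of_forall_lt_iff_le.1 fun z hz => ?_
  have hz := EReal.coe_lt_coe_iff.1 hz
  lift z to ℝ≥0 using hg.trans hz.le
  have key : dimH (levelSet μ α) ≤ z := by
    refine dimH_le_of_frequently (ν := gibbsMeasure p q hp) (s := (g + z) / 2) (by linarith)
      fun x hx => (hfreq x hx ((g + z) / 2) (by linarith)).mono fun n hn => ?_
    rw [gibbsMeasure_cylAt hp q hn.1]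
    refine ENNReal.rpow_le_rpow_of_exponent_le (by norm_num) (neg_le_neg ?_)
    exact mul_le_mul_of_nonneg_left hn.2.le n.cast_nonneg
  exact EReal.coe_ennreal_le_coe_ennreal_iff.2 key

/-- The hypothesis says that `q` is a critical point of `q ↦ α q + pressure p q`, or equivalently that
the mean exponent under the Gibbs measure at `q` is `α`. That measure then lives on the level set and
has exponent `α q + pressure p q` there. -/
theorem IsBernoulliProduct.le_hausdorffDim_levelSet {w : ℕ → ℝ} (hw : ∀ n, w n ∈ Ioo (0 : ℝ) 1)
    {p : ℝ} (hp : p ∈ Ioo (0 : ℝ) 1) (hwp : Tendsto w atTop (𝓝 p))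
    {μ : Measure Cantor} (h : IsBernoulliProduct w μ) {α q : ℝ}
    (hq : (α + Real.logb 2 p) * p ^ q + (α + Real.logb 2 (1 - p)) * (1 - p) ^ q = 0) :
    ((α * q + pressure p q : ℝ) : EReal) ≤ hausdorffDim (levelSet μ α) := by
  have hZ := partition_pos hp q
  have hmean : gibbsWeight p q * -Real.logb 2 p + (1 - gibbsWeight p q) * -Real.logb 2 (1 - p)
      = α := by
    rw [gibbsWeight]
    field_simp
    linarith
  have hae : ∀ᵐ x ∂(gibbsMeasure p q hp),
      Tendsto (fun n => coarseExp (fun _ => p) n x) atTop (𝓝 α) := by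
    have := ae_tendsto_birkhoff
      ⟨gibbsWeight p q, Ioo_subset_Icc_self (gibbsWeight_mem hp q)⟩
      fun c => -Real.logb 2 (letterWeight p c)
    simp only [letterWeight, if_true, Bool.false_eq_true, if_false, hmean] at this
    exact this
  have hmem (x : Cantor) (hx : Tendsto (fun n => coarseExp (fun _ => p) n x) atTop (𝓝 α)) :
      x ∈ levelSet μ α :=
    (h.mem_levelSet_iff hw hp hwp).2 ((continuous_coe_real_ereal.tendsto _).comp hx).liminf_eq
  have hne : (levelSet μ α).Nonempty := by
    obtain ⟨x, hx⟩ := hae.exists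
    exact ⟨x, hmem x hx⟩
  refine EReal.ge_of_forall_gt_iff_ge.1 fun z hz => ?_
  rcases le_or_gt z 0 with hz0 | hz0
  · exact (EReal.coe_le_coe_iff.2 hz0).trans (hausdorffDim_nonneg hne)
  have hz := EReal.coe_lt_coe_iff.1 hz
  rw [hausdorffDim_of_nonempty hne]
  lift z to ℝ≥0 using hz0.le
  have key : z ≤ dimH (levelSet μ α) := by
    refine le_dimH_of_ae_eventually (ν := gibbsMeasure p q hp) (NNReal.coe_pos.1 hz0) ?_
    filter_upwards [hae] with x hx
    refine ⟨hmem x hx, ?_⟩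
    have hlim : Tendsto (fun n => q * coarseExp (fun _ => p) n x + pressure p q) atTop
        (𝓝 (α * q + pressure p q)) := by
      rw [mul_comm α]; exact (hx.const_mul q).add_const _
    filter_upwards [hlim.eventually_const_lt hz, eventually_gt_atTop 0] with n hn hn0
    rw [gibbsMeasure_cylAt hp q hn0]
    refine ENNReal.rpow_le_rpow_of_exponent_le (by norm_num) (neg_le_neg ?_)
    exact mul_le_mul_of_nonneg_left hn.le n.cast_nonneg
  exact EReal.coe_ennreal_le_coe_ennreal_iff.2 key

end

/-! ### The Legendre transform and the multifractal formalism -/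

/-- The function to be minimized is `log₂ (2 ^ (c q) + 2 ^ (d q))`, where the signs of `c` and `d` tell
on which side of the two one-letter exponents `α` lies. -/
lemma mul_add_pressure {p : ℝ} (hp : p ∈ Ioo (0 : ℝ) 1) (α q : ℝ) :
    α * q + pressure p q = Real.logb 2 (2 ^ ((α + Real.logb 2 p) * q) +
      2 ^ ((α + Real.logb 2 (1 - p)) * q)) := by
  have h (t : ℝ) (ht : 0 < t) : (2 : ℝ) ^ ((α + Real.logb 2 t) * q) = 2 ^ (α * q) * t ^ q := by
    rw [add_mul, Real.rpow_add (by norm_num), Real.rpow_mul (by norm_num) (Real.logb 2 t),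
      Real.rpow_logb (by norm_num) (by norm_num) ht]
  rw [h p hp.1, h (1 - p) (sub_pos.2 hp.2), ← mul_add, Real.logb_mul (by positivity)
    (partition_pos hp q).ne', Real.logb_rpow (by norm_num) (by norm_num), pressure]

lemma tendsto_two_rpow_mul {l : Filter ℝ} {c : ℝ} (h : Tendsto (fun q => c * q) l atBot) :
    Tendsto (fun q => (2 : ℝ) ^ (c * q)) l (𝓝 0) :=
  (tendsto_rpow_atBot_of_base_gt_one 2 (by norm_num)).comp h

/-- Going to `+∞` or to `-∞` makes `d q` tend to `-∞` for all `d` of the sign of `c`. -/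
lemma exists_filter_mul_atBot {c : ℝ} (hc : c ≠ 0) :
    ∃ l : Filter ℝ, l.NeBot ∧ ∀ d, 0 < c * d → Tendsto (fun q => d * q) l atBot := by
  rcases hc.lt_or_gt with hc | hc
  · exact ⟨atTop, inferInstance, fun d hd =>
      tendsto_id.const_mul_atTop_of_neg (neg_of_mul_pos_right hd hc.le)⟩
  · exact ⟨atBot, inferInstance, fun d hd =>
      tendsto_id.const_mul_atBot ((pos_iff_pos_of_mul_pos hd).1 hc)⟩

lemma iInf_logb_eq_bot {c d : ℝ} (h : 0 < c * d) :
    ⨅ q : ℝ, ((Real.logb 2 (2 ^ (c * q) + 2 ^ (d * q)) : ℝ) : EReal) = ⊥ := by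
  have hc : c ≠ 0 := left_ne_zero_of_mul h.ne'
  obtain ⟨l, hl, H⟩ := exists_filter_mul_atBot hc
  have hsum : Tendsto (fun q : ℝ => (2 : ℝ) ^ (c * q) + 2 ^ (d * q)) l (𝓝[>] 0) := by
    refine tendsto_nhdsWithin_iff.2 ⟨?_, Eventually.of_forall fun q => ?_⟩
    · simpa using (tendsto_two_rpow_mul (H c (mul_self_pos.2 hc))).add (tendsto_two_rpow_mul (H d h))
    · simp only [mem_Ioi]; positivity
  have hlog : Tendsto (fun q : ℝ => Real.logb 2 ((2 : ℝ) ^ (c * q) + 2 ^ (d * q))) l atBot :=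
    (Real.tendsto_logb_nhdsGT_zero (by norm_num)).comp hsum
  exact le_bot_iff.1 (ge_of_tendsto' (EReal.tendsto_coe_nhds_bot_iff.2 hlog) fun q => iInf_le _ q)

lemma iInf_logb_one_add_le {c : ℝ} (hc : c ≠ 0) :
    ⨅ q : ℝ, ((Real.logb 2 (1 + 2 ^ (c * q)) : ℝ) : EReal) ≤ 0 := by
  obtain ⟨l, hl, H⟩ := exists_filter_mul_atBot hc
  have hsum : Tendsto (fun q : ℝ => 1 + (2 : ℝ) ^ (c * q)) l (𝓝 1) := by
    simpa using (tendsto_two_rpow_mul (H c (mul_self_pos.2 hc))).const_add 1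
  have hlog : Tendsto (fun q : ℝ => Real.logb 2 (1 + (2 : ℝ) ^ (c * q))) l (𝓝 0) := by
    simpa [Real.logb] using (hsum.log one_ne_zero).div_const (Real.log 2)
  exact ge_of_tendsto' ((continuous_coe_real_ereal.tendsto _).comp hlog) fun q => iInf_le _ q

/-- For `c` and `d` of opposite signs the balance `c p ^ q = -d (1 - p) ^ q` is solved by a logarithm
to the base `p / (1 - p)`, which is not `1`. -/
lemma exists_rpow_balance {p : ℝ} (hp : p ∈ Ioo (0 : ℝ) 1) {c d : ℝ} (hcd : c * d < 0)
    (hne : p ≠ 1 - p) : ∃ q : ℝ, c * p ^ q + d * (1 - p) ^ q = 0 := by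
  have hp1 : 0 < 1 - p := sub_pos.2 hp.2
  have hc : c ≠ 0 := left_ne_zero_of_mul hcd.ne
  have hy : 0 < -d / c := by
    have : -d / c = -(c * d) / c ^ 2 := by field_simp
    rw [this]
    exact div_pos (neg_pos.2 hcd) (by positivity)
  refine ⟨Real.logb (p / (1 - p)) (-d / c), ?_⟩
  have h := Real.rpow_logb (b := p / (1 - p)) (div_pos hp.1 hp1)
    (fun h => hne ((div_eq_one_iff_eq hp1.ne').1 h)) hy
  set q := Real.logb (p / (1 - p)) (-d / c)
  rw [Real.div_rpow hp.1.le hp1.le] at h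
  have : (1 - p) ^ q ≠ 0 := (Real.rpow_pos_of_pos hp1 _).ne'
  field_simp at h
  linarith

lemma coarseExp_const (t : ℝ) (c : Bool) {n : ℕ} (hn : 0 < n) :
    coarseExp (fun _ => t) n (fun _ => c) = -Real.logb 2 (letterWeight t c) := by
  have : (n : ℝ) ≠ 0 := by positivity
  simp only [coarseExp, Finset.sum_const, Finset.card_range, nsmul_eq_mul]
  field_simp

lemma IsBernoulliProduct.const_mem_levelSet {w : ℕ → ℝ} (hw : ∀ n, w n ∈ Ioo (0 : ℝ) 1) {p : ℝ}
    (hp : p ∈ Ioo (0 : ℝ) 1) (hwp : Tendsto w atTop (𝓝 p))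
    {μ : Measure Cantor} (h : IsBernoulliProduct w μ) {α : ℝ} (c : Bool)
    (hα : α + Real.logb 2 (letterWeight p c) = 0) : (fun _ => c) ∈ levelSet μ α := by
  rw [h.mem_levelSet_iff hw hp hwp]
  refine Tendsto.liminf_eq (tendsto_const_nhds.congr' ?_)
  filter_upwards [eventually_gt_atTop 0] with n hn
  rw [coarseExp_const p c hn, eq_neg_of_add_eq_zero_left hα]

theorem IsBernoulliProduct.multifractalFormalism {w : ℕ → ℝ} (hw : ∀ n, w n ∈ Ioo (0 : ℝ) 1)
    {p : ℝ} (hp : p ∈ Ioo (0 : ℝ) 1) (hwp : Tendsto w atTop (𝓝 p))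
    {μ : Measure Cantor} (h : IsBernoulliProduct w μ) : MultifractalFormalism μ := by
  intro α
  have hstar : tauStar μ α = ⨅ q : ℝ, ((α * q + pressure p q : ℝ) : EReal) := by
    simp only [tauStar, h.tau_eq hw hp hwp, pressure, EReal.coe_add]
  rw [hstar]
  refine le_antisymm (le_iInf fun q => h.hausdorffDim_levelSet_le hw hp hwp α q) ?_
  have lower {q : ℝ} (hq : (α + Real.logb 2 p) * p ^ q +
      (α + Real.logb 2 (1 - p)) * (1 - p) ^ q = 0) :=
    (iInf_le (fun q : ℝ => ((α * q + pressure p q : ℝ) : EReal)) q).trans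
      (h.le_hausdorffDim_levelSet hw hp hwp hq)
  have endpoint (b : Bool) (hα : α + Real.logb 2 (letterWeight p b) = 0)
      (hinf : ⨅ q : ℝ, ((α * q + pressure p q : ℝ) : EReal) ≤ 0) :=
    hinf.trans (hausdorffDim_nonneg ⟨_, h.const_mem_levelSet hw hp hwp b hα⟩)
  have hform := mul_add_pressure hp α
  -- When `α` is the exponent of both letters, any `q` balances; when it is that of one letter only,
  -- the constant sequence of this letter lies in the level set and the infimum is at most `0`.
  by_cases hc : α + Real.logb 2 p = 0
  · by_cases hd : α + Real.logb 2 (1 - p) = 0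
    · exact lower (q := 0) (by simp [hc, hd])
    · refine endpoint false (by simpa [letterWeight] using hc) ?_
      simpa [hform, hc] using iInf_logb_one_add_le hd
  by_cases hd : α + Real.logb 2 (1 - p) = 0
  · refine endpoint true (by simpa [letterWeight] using hd) ?_
    simpa [hform, hd, add_comm] using iInf_logb_one_add_le hc
  -- Between the exponents of the two letters there is a critical `q`; outside, the infimum is `⊥`.
  rcases (mul_ne_zero hc hd).lt_or_gt with hcd | hcd
  · obtain ⟨q, hq⟩ := exists_rpow_balance hp hcd fun hpp => by
      rw [← hpp] at hcd
      exact absurd hcd (not_lt.2 (mul_self_nonneg _))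
    exact lower hq
  · simp only [hform]
    rw [iInf_logb_eq_bot hcd]
    exact bot_le

/-! ### Hellinger affinity and singularity -/

/-- The Hellinger affinity of the coins of weights `s` and `t`. -/
def affinity (s t : ℝ) : ℝ := √(s * t) + √((1 - s) * (1 - t))

lemma affinity_comm (s t : ℝ) : affinity s t = affinity t s := by
  simp only [affinity, mul_comm]

lemma affinity_nonneg (s t : ℝ) : 0 ≤ affinity s t := by unfold affinity; positivity

lemma affinity_le {s t : ℝ} (hs : s ∈ Ioo (0 : ℝ) 1) (ht : t ∈ Ioo (0 : ℝ) 1) :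
    affinity s t ≤ 1 - (s - t) ^ 2 / 8 := by
  have hs1 : 0 ≤ 1 - s := sub_nonneg.2 hs.2.le
  have ht1 : 0 ≤ 1 - t := sub_nonneg.2 ht.2.le
  rw [affinity, Real.sqrt_mul hs.1.le, Real.sqrt_mul hs1]
  have h1 := Real.sq_sqrt hs.1.le
  have h2 := Real.sq_sqrt ht.1.le
  have h3 := Real.sq_sqrt hs1
  have h4 := Real.sq_sqrt ht1
  have h5 : √s ≤ 1 := Real.sqrt_le_one.2 hs.2.le
  have h6 : √t ≤ 1 := Real.sqrt_le_one.2 ht.2.le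
  have hdiff : (s - t) ^ 2 ≤ 4 * (√s - √t) ^ 2 := by
    have h7 : s - t = (√s - √t) * (√s + √t) := by linear_combination h2 - h1
    have h8 : (√s + √t) ^ 2 ≤ 4 := by
      have := Real.sqrt_nonneg s
      have := Real.sqrt_nonneg t
      nlinarith
    rw [h7, mul_pow, mul_comm]
    exact mul_le_mul_of_nonneg_right h8 (sq_nonneg _)
  nlinarith [sq_nonneg (√(1 - s) - √(1 - t))]

/-- On a cylinder where `μ ≤ β`, the mass `μ` is at most the geometric mean `√(μ β)`; the sum of the
geometric means over all cylinders of generation `n` is the product of the affinities. -/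
lemma IsBernoulliProduct.measure_le_affinity {w v : ℕ → ℝ} (hw : ∀ n, w n ∈ Ioo (0 : ℝ) 1)
    (hv : ∀ n, v n ∈ Ioo (0 : ℝ) 1) {μ β : Measure Cantor} (hμ : IsBernoulliProduct w μ)
    (hβ : IsBernoulliProduct v β) (n : ℕ) :
    μ {x | μ (cylAt n x) ≤ β (cylAt n x)} ≤
      ENNReal.ofReal (∏ j ∈ Finset.range n, affinity (w j) (v j)) := by
  classical
  have hposw (j : ℕ) (c : Bool) := (letterWeight_pos (hw j) c).le
  have hposv (j : ℕ) (c : Bool) := (letterWeight_pos (hv j) c).le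
  have hcylw (e : Fin n → Bool) :
      μ (cyl e) = ENNReal.ofReal (∏ j : Fin n, letterWeight (w j) (e j)) := hμ n e
  have hcylv (e : Fin n → Bool) :
      β (cyl e) = ENNReal.ofReal (∏ j : Fin n, letterWeight (v j) (e j)) := hβ n e
  have hle (e : Fin n → Bool) (he : μ (cyl e) ≤ β (cyl e)) : μ (cyl e) ≤
      ENNReal.ofReal (∏ j : Fin n, √(letterWeight (w j) (e j) * letterWeight (v j) (e j))) := by
    have hB : 0 ≤ ∏ j : Fin n, letterWeight (v j) (e j) := Finset.prod_nonneg fun j _ => hposv j _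
    have hA : 0 ≤ ∏ j : Fin n, letterWeight (w j) (e j) := Finset.prod_nonneg fun j _ => hposw j _
    rw [hcylw, hcylv, ENNReal.ofReal_le_ofReal_iff hB] at he
    rw [hcylw]
    refine ENNReal.ofReal_le_ofReal ?_
    rw [← Real.sqrt_prod _ fun (j : Fin n) _ => mul_nonneg (hposw j (e j)) (hposv j (e j)),
      Finset.prod_mul_distrib]
    exact Real.le_sqrt_of_sq_le (by rw [sq]; exact mul_le_mul_of_nonneg_left he hA)
  have hsub : {x | μ (cylAt n x) ≤ β (cylAt n x)} ⊆
      ⋃ e ∈ Finset.univ.filter fun e : Fin n → Bool => μ (cyl e) ≤ β (cyl e), cyl e := by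
    intro x hx
    simp only [Finset.mem_filter_univ, mem_iUnion]
    exact ⟨fun i => x i, hx, mem_cylAt_self n x⟩
  calc μ {x | μ (cylAt n x) ≤ β (cylAt n x)}
      ≤ ∑ e : Fin n → Bool with μ (cyl e) ≤ β (cyl e), μ (cyl e) :=
        (measure_mono hsub).trans (measure_biUnion_finset_le _ _)
    _ ≤ ∑ e : Fin n → Bool with μ (cyl e) ≤ β (cyl e),
          ENNReal.ofReal (∏ j : Fin n, √(letterWeight (w j) (e j) * letterWeight (v j) (e j))) :=
        Finset.sum_le_sum fun e he => hle e (Finset.mem_filter.1 he).2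
    _ ≤ ∑ e : Fin n → Bool,
          ENNReal.ofReal (∏ j : Fin n, √(letterWeight (w j) (e j) * letterWeight (v j) (e j))) :=
        Finset.sum_le_univ_sum_of_nonneg fun _ => zero_le
    _ = ENNReal.ofReal (∏ j ∈ Finset.range n, affinity (w j) (v j)) := by
        rw [← ENNReal.ofReal_sum_of_nonneg fun e _ => Finset.prod_nonneg fun j _ =>
          Real.sqrt_nonneg _]
        rw [sum_words_prod n fun j c => √(letterWeight (w j) c * letterWeight (v j) c)]
        simp [affinity, letterWeight]

/-- The divergent half of Kakutani's dichotomy: along a subsequence of generations, the sets where one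
measure gives the cylinder at most the mass that the other does have
summable mass for the first, and Borel–Cantelli applies. -/
theorem IsBernoulliProduct.mutuallySingular {w v : ℕ → ℝ} (hw : ∀ n, w n ∈ Ioo (0 : ℝ) 1)
    (hv : ∀ n, v n ∈ Ioo (0 : ℝ) 1)
    (hdiv : Tendsto (fun n => ∑ j ∈ Finset.range n, (w j - v j) ^ 2) atTop atTop)
    {μ β : Measure Cantor} (hμ : IsBernoulliProduct w μ) (hβ : IsBernoulliProduct v β) :
    Measure.MutuallySingular μ β := by
  have hzero : Tendsto (fun n => ∏ j ∈ Finset.range n, affinity (w j) (v j)) atTop (𝓝 0) := by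
    refine squeeze_zero (fun n => Finset.prod_nonneg fun j _ => affinity_nonneg _ _) (fun n => ?_)
      (Real.tendsto_exp_neg_atTop_nhds_zero.comp (hdiv.atTop_div_const (by norm_num : (0 : ℝ) < 8)))
    rw [Function.comp_apply, Finset.sum_div, ← Finset.sum_neg_distrib, Real.exp_sum]
    refine Finset.prod_le_prod (fun j _ => affinity_nonneg _ _) fun j _ => ?_
    exact (affinity_le (hw j) (hv j)).trans (Real.one_sub_le_exp_neg _)
  have hchoose (k : ℕ) : ∃ n, ∏ j ∈ Finset.range n, affinity (w j) (v j) ≤ (1 / 2) ^ k :=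
    (hzero.eventually_le_const (by positivity)).exists
  choose n hn using hchoose
  have hsum : ∑' k : ℕ, ENNReal.ofReal ((1 / 2) ^ k) ≠ ∞ := summable_geometric_two.tsum_ofReal_ne_top
  set A : ℕ → Set Cantor := fun k => {x | μ (cylAt (n k) x) ≤ β (cylAt (n k) x)}
  set B : ℕ → Set Cantor := fun k => {x | β (cylAt (n k) x) ≤ μ (cylAt (n k) x)}
  have hA : μ (limsup A atTop) = 0 := by
    refine measure_limsup_atTop_eq_zero (ne_top_of_le_ne_top hsum (ENNReal.tsum_le_tsum fun k => ?_))
    exact (hμ.measure_le_affinity hw hv hβ (n k)).trans (ENNReal.ofReal_le_ofReal (hn k))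
  have hB : β (limsup B atTop) = 0 := by
    refine measure_limsup_atTop_eq_zero (ne_top_of_le_ne_top hsum (ENNReal.tsum_le_tsum fun k => ?_))
    refine (hβ.measure_le_affinity hv hw hμ (n k)).trans (ENNReal.ofReal_le_ofReal ?_)
    simpa only [affinity_comm] using hn k
  refine Measure.MutuallySingular.mk hA hB fun x _ => ?_
  rw [mem_union, mem_limsup_iff_frequently_mem, mem_limsup_iff_frequently_mem,
    ← frequently_or_distrib]
  exact Eventually.frequently (Eventually.of_forall fun k =>
    le_total (μ (cylAt (n k) x)) (β (cylAt (n k) x)))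

lemma exists_isBernoulliProduct {w : ℕ → ℝ} (hw : ∀ n, w n ∈ Ioo (0 : ℝ) 1) :
    ∃ μ : Measure Cantor, IsBernoulliProduct w μ :=
  ⟨_, isBernoulliProduct_bernoulliMeasure fun n => ⟨w n, Ioo_subset_Icc_self (hw n)⟩⟩

/-- The deviations `w n - p`, of order `n ^ (-1/2)`, tend to `0` without being square summable. -/
lemma exists_tendsto_sum_sq_atTop {p : ℝ} (hp : p ∈ Ioo (0 : ℝ) 1) :
    ∃ w : ℕ → ℝ, (∀ n, w n ∈ Ioo (0 : ℝ) 1) ∧ Tendsto w atTop (𝓝 p) ∧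
      Tendsto (fun n => ∑ j ∈ Finset.range n, (w j - p) ^ 2) atTop atTop := by
  have hp1 : 0 < 1 - p := sub_pos.2 hp.2
  refine ⟨fun n => p + (1 - p) / 2 * √(1 / (n + 1)), fun n => ?_, ?_, ?_⟩
  · have h1 : √(1 / ((n : ℝ) + 1)) ≤ 1 := by
      rw [Real.sqrt_le_one, div_le_one (by positivity)]
      linarith [n.cast_nonneg (α := ℝ)]
    have h2 : 0 ≤ √(1 / ((n : ℝ) + 1)) := Real.sqrt_nonneg _
    constructor
    · have := hp.1
      positivity
    · nlinarith
  · have h := (Real.continuous_sqrt.tendsto 0).comp tendsto_one_div_add_atTop_nhds_zero_nat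
    simpa using (h.const_mul ((1 - p) / 2)).const_add p
  · have h (j : ℕ) : (p + (1 - p) / 2 * √(1 / ((j : ℝ) + 1)) - p) ^ 2
        = ((1 - p) / 2) ^ 2 * (1 / ((j : ℝ) + 1)) := by
      rw [add_sub_cancel_left, mul_pow, Real.sq_sqrt (by positivity)]
    simp only [h, ← Finset.mul_sum]
    exact Real.tendsto_sum_range_one_div_nat_succ_atTop.const_mul_atTop (by positivity)

end

end BernoulliProduct

open BernoulliProduct in
theorem corollary1p3 (p : ℝ) (hp : p ∈ Set.Ioo (0 : ℝ) 1) :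
    (∀ w : ℕ → ℝ, (∀ n, w n ∈ Set.Ioo (0 : ℝ) 1) → Filter.Tendsto w Filter.atTop (nhds p) →
      ∀ μ : MeasureTheory.Measure Cantor, IsBernoulliProduct w μ →
        (∀ β : MeasureTheory.Measure Cantor, IsBernoulliProduct (fun _ => p) β →
          tau μ = tau β) ∧
        (∀ q : ℝ, tau μ q = ((Real.logb 2 (p ^ q + (1 - p) ^ q) : ℝ) : EReal)) ∧
        MultifractalFormalism μ) ∧
    (∃ w : ℕ → ℝ, (∀ n, w n ∈ Set.Ioo (0 : ℝ) 1) ∧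
      Filter.Tendsto w Filter.atTop (nhds p) ∧
      ∃ μ β : MeasureTheory.Measure Cantor, IsBernoulliProduct w μ ∧
        IsBernoulliProduct (fun _ => p) β ∧ MeasureTheory.Measure.MutuallySingular μ β) := by
  refine ⟨fun w hw hwp μ hμ => ⟨fun β hβ => funext fun q => ?_, hμ.tau_eq hw hp hwp,
    hμ.multifractalFormalism hw hp hwp⟩, ?_⟩
  · rw [hμ.tau_eq hw hp hwp, hβ.tau_eq (fun _ => hp) hp tendsto_const_nhds]
  · obtain ⟨w, hw, hwp, hdiv⟩ := exists_tendsto_sum_sq_atTop hp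
    obtain ⟨μ, hμ⟩ := exists_isBernoulliProduct hw
    obtain ⟨β, hβ⟩ := exists_isBernoulliProduct (w := fun _ => p) fun _ => hp
    exact ⟨w, hw, hwp, μ, β, hμ, hβ, hμ.mutuallySingular hw (fun _ => hp) hdiv hβ⟩
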